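/- Let $V$ be an infinite set of variables and $A$ a set of actions with $|A|\le|V|$, and let $\Sigma$ be a single-sorted first-order signature (function symbols $f$ with arities $ar(f)\in\mathbb N$) with $|\Sigma|\le|V|$. Literals are $t\xrightarrow{a}t'$ (positive) and $t\stackrel{a}{\not\rightarrow}$ (negative), where $t,t'$ are terms over $\Sigma$ and $V$ and $a\in A$; these two literals deny each other. A transition rule $\frac H\alpha$ has an arbitrary set $H$ of literals as premises and a literal $\alpha$ as conclusion. The left-hand side of $\alpha$ is the source of the rule, and its right-hand side (if any) is the target. A transition system specification (TSS) $P=(\Sigma,R)$ is a signature with a set $R$ of rules; it is standard if all conclusions are positive. Provability. A proof of $\frac H\alpha$ from $P$ is a well-founded, upwardly branching tree of literals with root $\alpha$ in which every node either is a leaf in $H$ or, together with the set of labels of the nodes directly above it, forms a substitution instance of a rule in $R$. A well-supported proof of a closed literal $\alpha$ from $P$ is a well-founded, upwardly branching tree of closed literals with root $\alpha$ such that, for each node with label $\beta$ and set $K$ of labels directly above it, either $\frac K\beta$ is a closed substitution instance of a rule in $R$, or $\beta$ is negative and for every set $N$ of closed negative literals such that $\frac N\gamma$ is provable from $P$ for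 some closed literal $\gamma$ denying $\beta$, a literal in $K$ denies one in $N$. Write $P\vdash_{ws}\alpha$ if such a tree exists. Readiness preorder. Readiness observations are given by $$\varphi ::= \top \mid a\varphi' \mid \textstyle\bigwedge_{i\in I}\widetilde{a_i}\wedge\bigwedge_{j\in J}b_j\top ,$$ where $\varphi'$ is a readiness observation and $I,J$ are arbitrary index sets. For closed terms $p$: $p\models\top$ always; $p\models a\varphi$ iff there is a closed term $q$ with $P\vdash_{ws}p\xrightarrow{a}q$ and $q\models\varphi$; $p\models\widetilde a$ iff $P\vdash_{ws}p\stackrel{a}{\not\rightarrow}$; conjunction is as usual. The readiness preorder induced by $P$ is: $p\sqsubseteq_R^P q$ iff every readiness observation satisfied by $p$ is satisfied by $q$. Readiness format. A rule is ntytt if the right-hand sides of its positive premises are distinct variables that do not occur in its source. It is ntyxt if moreover its source is a variable, and ntyft if moreover its source has the form $f(x_1,\dots,x_n)$ with $x_1,\dots,x_n$ distinct variables. A rule has no lookahead if no variable in the right-hand side of a positive premise occurs in the left-hand side of a premise. In an ntytt rule, an occurrence of a variable is propagated if it is in the target, or in the left-hand side of a positive premise whose right-hand side occurs in the target; it is polled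 if it is in the left-hand side of a premise that does not have a right-hand side occurring in the target. Let $\Lambda$ be a predicate on pairs $(f,i)$ with $f\in\Sigma$ and $1\le i\le ar(f)$; argument $i$ of $f$ is liquid if $\Lambda(f,i)$. An occurrence of a variable in a term is at a $\Lambda$-liquid position if the path to it from the root passes through liquid arguments only. A variable is $\Lambda$-floating in an ntytt rule if it is the right-hand side of a positive premise, or it occurs exactly once in the source, at a $\Lambda$-liquid position. A standard ntytt rule is $\Lambda$-ready trace safe if it has no lookahead and each $\Lambda$-floating variable has at most one propagated occurrence, which must be at a $\Lambda$-liquid position. It is $\Lambda$-readiness safe if moreover no $\Lambda$-floating variable has both propagated and polled occurrences. A standard TSS is in readiness format if all its rules are ntyft or ntyxt rules and there is a single $\Lambda$ such that all its rules are $\Lambda$-readiness safe. Theorem. If a standard TSS $P$ over $\Sigma$ is in readiness format, then the readiness preorder $\sqsubseteq_R^P$ on closed terms is a precongruence: it is a preorder, and for every function symbol $f$, if $p_i\sqsubseteq_R^P q_i$ for $i=1,\dots,ar(f)$, then $f(p_1,\dots,p_{ar(f)})\sqsubseteq_R^P f(q_1,\dots,q_{ar(f)})$. -/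

import Mathlib

/-!
Transition system specifications, well-supported provability, the readiness preorder, and the
readiness format.  A signature is (the function part of) a first-order language `L`; relation
symbols of `L`, if any, play no role.  Open terms are `L.Term V` with `V` the set of variables,
closed terms are `L.Term Empty`, and `A` is the set of actions.
-/

namespace SOS

universe uF uR u v w

/-! ### Literals, rules and transition system specifications -/

/-- Literals over the signature `L`, actions `A`, and variables from `X`
(`X = V` for arbitrary literals, `X = Empty` for closed literals). -/
inductive Literal (L : FirstOrder.Language.{uF, uR}) (A : Type u) (X : Type w) : Type (max uF u w)
  /-- the positive literal `t --a--> t'` -/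
  | pos (t : L.Term X) (a : A) (t' : L.Term X) : Literal L A X
  /-- the negative literal, which says that `t` has no `a`-transition -/
  | neg (t : L.Term X) (a : A) : Literal L A X

variable {L : FirstOrder.Language.{uF, uR}} {A : Type u} {V : Type v} {X : Type w}

namespace Literal

/-- Left-hand side of a literal. -/
def lhs : Literal L A X → L.Term X
  | pos t _ _ => t
  | neg t _ => t

/-- `u` is the right-hand side of the literal (negative literals have none). -/
def HasRhs : Literal L A X → L.Term X → Prop
  | pos _ _ t', u => t' = u
  | neg _ _, _ => False

def IsPos : Literal L A X → Prop
  | pos _ _ _ => True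
  | neg _ _ => False

def IsNeg : Literal L A X → Prop
  | pos _ _ _ => False
  | neg _ _ => True

/-- The positive literal `pos t a t'` and the negative literal `neg t a` deny each other. -/
def Denies : Literal L A X → Literal L A X → Prop
  | pos t a _, neg s b => t = s ∧ a = b
  | neg t a, pos s b _ => t = s ∧ a = b
  | _, _ => False

/-- Application of a substitution to a literal. -/
def subst {Y : Type*} (σ : X → L.Term Y) : Literal L A X → Literal L A Y
  | pos t a t' => pos (t.subst σ) a (t'.subst σ)
  | neg t a => neg (t.subst σ) a

/-- A closed literal, seen as a literal over the variables `V`. -/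
def ofClosed (V : Type v) : Literal L A Empty → Literal L A V :=
  subst (fun e => e.elim)

end Literal

/-- A transition rule: a set of premises and a conclusion. -/
structure Rule (L : FirstOrder.Language.{uF, uR}) (A : Type u) (V : Type v) where
  premises : Set (Literal L A V)
  conclusion : Literal L A V

/-- A transition system specification over the signature `L`: a collection of rules. -/
structure TSS (L : FirstOrder.Language.{uF, uR}) (A : Type u) (V : Type v) where
  rules : Set (Rule L A V)

/-- A TSS is standard if all its rules have positive conclusions. -/
def TSS.IsStandard (P : TSS L A V) : Prop :=
  ∀ r ∈ P.rules, r.conclusion.IsPos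

/-- `P.Provable H α`: there is a proof of the rule `H / α` from `P`, i.e. a well-founded,
upwardly branching tree with root `α` whose leaves may be hypotheses from `H` and in which every
other node, with the labels of the nodes directly above it, is a substitution instance of a rule
of `P`.  (A partial substitution is extended by the identity to a total one.) -/
inductive TSS.Provable (P : TSS L A V) (H : Set (Literal L A V)) : Literal L A V → Prop
  | hyp (α : Literal L A V) (hα : α ∈ H) : TSS.Provable P H α
  | step (r : Rule L A V) (hr : r ∈ P.rules) (σ : V → L.Term V)
      (above : ∀ β ∈ r.premises, TSS.Provable P H (β.subst σ)) :
      TSS.Provable P H (r.conclusion.subst σ)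

/-- `P.WSProvable α`: there is a well-supported proof of the closed literal `α` from `P`.
The two constructors are the two kinds of nodes of a well-supported proof; the second one is
negation as failure, with `K` the set of labels of the nodes directly above. -/
inductive TSS.WSProvable (P : TSS L A V) : Literal L A Empty → Prop
  | step (r : Rule L A V) (hr : r ∈ P.rules) (σ : V → L.Term Empty)
      (above : ∀ β ∈ r.premises, TSS.WSProvable P (β.subst σ)) :
      TSS.WSProvable P (r.conclusion.subst σ)
  | naf (β : Literal L A Empty) (hβ : β.IsNeg) (K : Set (Literal L A Empty))
      (above : ∀ κ ∈ K, TSS.WSProvable P κ)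
      (refutes : ∀ N : Set (Literal L A Empty), (∀ ν ∈ N, ν.IsNeg) →
        ∀ γ : Literal L A Empty, γ.Denies β →
          P.Provable (Literal.ofClosed V '' N) (γ.ofClosed V) →
            ∃ κ ∈ K, ∃ ν ∈ N, κ.Denies ν) :
      TSS.WSProvable P β

/-! ### Observations and the readiness preorder -/

/-- Ready simulation observations (modal formulas) over `A`, with arbitrary conjunctions. -/
inductive Obs (A : Type u) : Type (u + 1)
  | top : Obs A
  | act (a : A) (φ : Obs A) : Obs A
  | refuse (a : A) : Obs A
  | conj {ι : Type u} (φ : ι → Obs A) : Obs A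

/-- Binary conjunction, as a conjunction over a two-element index set. -/
def Obs.and (φ ψ : Obs A) : Obs A :=
  Obs.conj (ι := ULift.{u} Bool) fun b => if b.down then φ else ψ

/-- The readiness observations
`φ ::= ⊤ | a φ' | (⋀ i, refuse (a i)) ∧ (⋀ j, (b j) ⊤)`. -/
inductive Obs.IsReadiness : Obs A → Prop
  | top : Obs.IsReadiness Obs.top
  | act (a : A) (φ : Obs A) (hφ : Obs.IsReadiness φ) : Obs.IsReadiness (Obs.act a φ)
  | ready {I J : Type u} (a : I → A) (b : J → A) :
      Obs.IsReadiness ((Obs.conj fun i => Obs.refuse (a i)).and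
        (Obs.conj fun j => Obs.act (b j) Obs.top))

/-- Satisfaction of an observation by a closed term, with respect to the three-valued transition
relation of all literals with a well-supported proof from `P`. -/
def TSS.Sat (P : TSS L A V) : L.Term Empty → Obs A → Prop
  | _, Obs.top => True
  | p, Obs.act a φ => ∃ q : L.Term Empty, P.WSProvable (Literal.pos p a q) ∧ P.Sat q φ
  | p, Obs.refuse a => P.WSProvable (Literal.neg p a)
  | p, Obs.conj φ => ∀ i, P.Sat p (φ i)

/-- The set of readiness observations of a closed term. -/
def TSS.readinessObs (P : TSS L A V) (p : L.Term Empty) : Set (Obs A) :=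
  {φ | φ.IsReadiness ∧ P.Sat p φ}

/-- The readiness preorder induced by `P`. -/
def TSS.ReadinessLE (P : TSS L A V) (p q : L.Term Empty) : Prop :=
  P.readinessObs p ⊆ P.readinessObs q

/-- A relation on closed terms is a precongruence if it is a preorder that is preserved by all
function symbols of the signature. -/
def IsPrecongruence (rel : L.Term Empty → L.Term Empty → Prop) : Prop :=
  (∀ p, rel p p) ∧ (∀ p q s, rel p q → rel q s → rel p s) ∧
    ∀ (n : ℕ) (f : L.Functions n) (p q : Fin n → L.Term Empty),
      (∀ i, rel (p i) (q i)) → rel (FirstOrder.Language.Term.func f p) (FirstOrder.Language.Term.func f q)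

/-! ### Occurrences of variables -/

/-- `OccursAt x t π`: the variable `x` occurs in `t` at the position `π`, where a position is the
list of the (zero-based) argument numbers on the path from the root of `t`. -/
def OccursAt (x : V) : L.Term V → List ℕ → Prop
  | FirstOrder.Language.Term.var y, π => y = x ∧ π = []
  | FirstOrder.Language.Term.func _ _, [] => False
  | FirstOrder.Language.Term.func _ ts, k :: π => ∃ i : Fin _, (i : ℕ) = k ∧ OccursAt x (ts i) π

/-- `x ∈ var(t)`. -/
def Occurs (x : V) (t : L.Term V) : Prop := ∃ π, OccursAt x t π

/-- A unary predicate on arguments of function symbols: `Λ f i` says that the argument `i` of `f`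
is liquid (otherwise it is frozen). -/
abbrev ArgPred (L : FirstOrder.Language.{uF, uR}) := ∀ ⦃n : ℕ⦄, L.Functions n → Fin n → Prop

/-- `LiquidAt Λ t π`: `π` is a position of `t`, and the path to it passes through `Λ`-liquid
arguments only. -/
def LiquidAt (Λ : ArgPred L) : L.Term V → List ℕ → Prop
  | _, [] => True
  | FirstOrder.Language.Term.var _, _ :: _ => False
  | FirstOrder.Language.Term.func f ts, k :: π => ∃ i : Fin _, (i : ℕ) = k ∧ Λ f i ∧ LiquidAt Λ (ts i) π

/-! ### Rule formats -/

namespace Rule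

/-- The source of a rule: the left-hand side of its conclusion. -/
def source (r : Rule L A V) : L.Term V := r.conclusion.lhs

/-- `x` occurs in the target of `r` (the right-hand side, if any, of its conclusion). -/
def OccursInTarget (r : Rule L A V) (x : V) : Prop :=
  ∃ u, r.conclusion.HasRhs u ∧ Occurs x u

/-- Right-hand sides of positive premises are variables, all distinct, not in the source. -/
def IsNtytt (r : Rule L A V) : Prop :=
  (∀ β ∈ r.premises, ∀ u, β.HasRhs u → ∃ y : V, u = FirstOrder.Language.Term.var y) ∧
  (∀ β ∈ r.premises, ∀ β' ∈ r.premises, ∀ u, β.HasRhs u → β'.HasRhs u → β = β') ∧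
  (∀ β ∈ r.premises, ∀ y : V, β.HasRhs (FirstOrder.Language.Term.var y) → ¬ Occurs y r.source)

/-- An ntytt rule whose source is a variable. -/
def IsNtyxt (r : Rule L A V) : Prop :=
  r.IsNtytt ∧ ∃ x : V, r.source = FirstOrder.Language.Term.var x

/-- An ntytt rule whose source is `f(x₁,…,xₙ)` with distinct variables `x₁,…,xₙ`, that is,
contains exactly one function symbol and no multiple occurrences of variables. -/
def IsNtyft (r : Rule L A V) : Prop :=
  r.IsNtytt ∧ ∃ (n : ℕ) (f : L.Functions n) (x : Fin n → V),
    Function.Injective x ∧ r.source = FirstOrder.Language.Term.func f fun i => FirstOrder.Language.Term.var (x i)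

/-- Variables in right-hand sides of positive premises do not occur in left-hand sides of
premises. -/
def NoLookahead (r : Rule L A V) : Prop :=
  ∀ β ∈ r.premises, ∀ u, β.HasRhs u → ∀ y, Occurs y u → ∀ β' ∈ r.premises, ¬ Occurs y β'.lhs

/-- The right-hand side of the premise `β` exists and occurs in the target of `r`
(in an ntytt rule this right-hand side is a variable). -/
def RhsInTarget (r : Rule L A V) (β : Literal L A V) : Prop :=
  ∃ y : V, β.HasRhs (FirstOrder.Language.Term.var y) ∧ r.OccursInTarget y

/-- The terms of a rule in which variables can be propagated or polled: the target, and the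
left-hand sides of premises. -/
inductive Place (L : FirstOrder.Language.{uF, uR}) (A : Type u) (V : Type v) : Type (max uF u v)
  | target : Place L A V
  | premise (β : Literal L A V) : Place L A V

/-- `r.TermAt pl t`: `t` is the term at the place `pl` of `r`. -/
def TermAt (r : Rule L A V) : Place L A V → L.Term V → Prop
  | Place.target, t => r.conclusion.HasRhs t
  | Place.premise β, t => β ∈ r.premises ∧ β.lhs = t

/-- Occurrences at this place are propagated: it is the target, or the left-hand side of a
positive premise whose right-hand side occurs in the target. -/
def IsPropagatingPlace (r : Rule L A V) : Place L A V → Prop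
  | Place.target => True
  | Place.premise β => r.RhsInTarget β

/-- Occurrences at this place are polled: it is the left-hand side of a premise that does not have
a right-hand side occurring in the target. -/
def IsPollingPlace (r : Rule L A V) : Place L A V → Prop
  | Place.target => False
  | Place.premise β => ¬ r.RhsInTarget β

/-- The occurrence of `x` at position `π` of the term `t` at the place `pl` is propagated. -/
def PropagatedAt (r : Rule L A V) (x : V) (pl : Place L A V) (t : L.Term V) (π : List ℕ) : Prop :=
  r.TermAt pl t ∧ OccursAt x t π ∧ r.IsPropagatingPlace pl

/-- The occurrence of `x` at position `π` of the term `t` at the place `pl` is polled. -/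
def PolledAt (r : Rule L A V) (x : V) (pl : Place L A V) (t : L.Term V) (π : List ℕ) : Prop :=
  r.TermAt pl t ∧ OccursAt x t π ∧ r.IsPollingPlace pl

/-- `x` is the right-hand side of a positive premise, or it occurs exactly once in the source, at a
`Λ`-liquid position. -/
def Floating (Λ : ArgPred L) (r : Rule L A V) (x : V) : Prop :=
  (∃ β ∈ r.premises, β.HasRhs (FirstOrder.Language.Term.var x)) ∨
  (∃ π, OccursAt x r.source π ∧ (∀ π', OccursAt x r.source π' → π' = π) ∧ LiquidAt Λ r.source π)

/-- No lookahead, and each `Λ`-floating variable has at most one propagated occurrence, which must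
be at a `Λ`-liquid position. -/
def ReadyTraceSafe (Λ : ArgPred L) (r : Rule L A V) : Prop :=
  r.NoLookahead ∧
  ∀ x, r.Floating Λ x →
    (∀ pl t π pl' t' π', r.PropagatedAt x pl t π → r.PropagatedAt x pl' t' π' →
      pl = pl' ∧ π = π') ∧
    (∀ pl t π, r.PropagatedAt x pl t π → LiquidAt Λ t π)

/-- `Λ`-ready trace safe, and no `Λ`-floating variable has both propagated and polled
occurrences. -/
def ReadinessSafe (Λ : ArgPred L) (r : Rule L A V) : Prop :=
  r.ReadyTraceSafe Λ ∧
  ∀ x, r.Floating Λ x →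
    ¬ ((∃ pl t π, r.PropagatedAt x pl t π) ∧ (∃ pl t π, r.PolledAt x pl t π))

end Rule

/-- All rules are ntyft or ntyxt rules. -/
def TSS.IsNtyftNtyxt (P : TSS L A V) : Prop :=
  ∀ r ∈ P.rules, r.IsNtyft ∨ r.IsNtyxt

/-- Readiness format (for standard TSSs). -/
def TSS.InReadinessFormat (P : TSS L A V) : Prop :=
  P.IsNtyftNtyxt ∧ ∃ Λ : ArgPred L, ∀ r ∈ P.rules, r.ReadinessSafe Λ

end SOS

/-!
The readiness preorder of a standard TSS in readiness format is a precongruence.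

Congruence is proved for contexts rather than for single function symbols: if `p` and `q` are built
by the same function symbols from subterms related by the preorder (`CongrClosure`), then every
readiness observation of `p` holds for `q` (`TSS.sat_of_congrClosure`).  The proof is by induction
on the observation, with inner inductions on well-supported proofs.

Since rules have no lookahead, the premises of a rule can be satisfied independently
(`Rule.exists_instance`), and a source `x` or `f(x₁,…,xₙ)` does not inspect its arguments.  Hence the
initial actions and the refusals of a term depend monotonically on those of its subterms
(`TSS.initialLE_of_congrClosure`).  A refusal says that there is no proof of a transition from
negative literals that are left undenied; the monotonicity is then shown by pulling such proofs back
along the relation.  This settles the observations of ready sets.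

For an observation `a φ` of `p`, each right-hand side of a premise that occurs in the target of the
last rule is floating, so it occurs there once, at a liquid position: the target is a liquid context
(`LiquidContext`) in this variable.  The central fact is that a readiness observation of `D p`, for a
liquid context `D`, is guaranteed by one readiness observation of `p`
(`TSS.exists_obs_of_liquidContext`).  This is where readiness safety enters: along a transition of
`D p`, the process `p` is passed on unchanged, or contributes a single transition whose target is
passed on, or is inspected for its initial actions and refusals and then disappears; no floating
variable is used in more than one of these ways (`TSS.ContextStep`).  So the values of the right-hand sides can be replaced one at
a time (`TSS.WSProvable.exists_of_congrClosure`), after which the induction hypothesis for `φ`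
replaces the values of the other variables of the target.
-/

namespace SOS

universe uF uR u v

variable {L : FirstOrder.Language.{uF, uR}} {A : Type u} {V : Type v}

open FirstOrder.Language (Term)
open FirstOrder.Language.Term (var func)

/-! ### Substitutions -/

theorem occurs_var {x y : V} : Occurs x (var y : L.Term V) ↔ y = x :=
  ⟨fun ⟨_, h⟩ => h.1, fun h => ⟨[], h, rfl⟩⟩

theorem occurs_func {x : V} {n : ℕ} {f : L.Functions n} {ts : Fin n → L.Term V} :
    Occurs x (func f ts) ↔ ∃ i, Occurs x (ts i) := by
  constructor
  · rintro ⟨_ | ⟨k, π⟩, h⟩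
    · exact h.elim
    · obtain ⟨i, -, h⟩ := h
      exact ⟨i, π, h⟩
  · rintro ⟨i, π, h⟩
    exact ⟨(i : ℕ) :: π, i, rfl, h⟩

theorem subst_congr {Y : Type*} {σ τ : V → L.Term Y} {t : L.Term V}
    (h : ∀ x, Occurs x t → σ x = τ x) : t.subst σ = t.subst τ := by
  induction t with
  | var y => exact h y (occurs_var.2 rfl)
  | func f ts ih =>
    simp only [FirstOrder.Language.Term.subst]
    congr 1
    funext i
    exact ih i fun x hx => h x (occurs_func.2 ⟨i, hx⟩)

theorem subst_update_of_not_occurs [DecidableEq V] {Y : Type*} {σ : V → L.Term Y} {t : L.Term V}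
    {x : V} (h : ¬ Occurs x t) (p : L.Term Y) : t.subst (Function.update σ x p) = t.subst σ :=
  subst_congr fun _ hz => Function.update_of_ne (by rintro rfl; exact h hz) _ _

theorem finite_setOf_occurs (t : L.Term V) : {x | Occurs x t}.Finite := by
  induction t with
  | var y =>
    refine (Set.finite_singleton y).subset fun x hx => ?_
    exact (occurs_var.1 hx).symm
  | func f ts ih =>
    refine (Set.finite_iUnion ih).subset fun x hx => ?_
    simpa using occurs_func.1 hx

theorem subst_subst {X Y Z : Type*} (σ : X → L.Term Y) (τ : Y → L.Term Z) (t : L.Term X) :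
    (t.subst σ).subst τ = t.subst fun x => (σ x).subst τ := by
  induction t with
  | var y => rfl
  | func f ts ih => simp only [FirstOrder.Language.Term.subst, ih]

theorem subst_closed (σ : Empty → L.Term Empty) (t : L.Term Empty) : t.subst σ = t := by
  induction t with
  | var y => exact y.elim
  | func f ts ih => simp only [FirstOrder.Language.Term.subst, ih]

namespace Literal

theorem subst_subst {X Y Z : Type*} (σ : X → L.Term Y) (τ : Y → L.Term Z) (α : Literal L A X) :
    (α.subst σ).subst τ = α.subst fun x => (σ x).subst τ := by
  cases α <;> simp only [subst, SOS.subst_subst]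

theorem subst_ofClosed (τ : V → L.Term Empty) (α : Literal L A Empty) :
    (α.ofClosed V).subst τ = α := by
  cases α <;> simp only [ofClosed, subst, SOS.subst_subst, SOS.subst_closed]

end Literal

/-! ### Well-supported provability through closed proofs -/

/-- Provability from closed hypotheses by closed substitution instances of rules only. -/
inductive TSS.ClosedProvable (P : TSS L A V) (N : Set (Literal L A Empty)) :
    Literal L A Empty → Prop
  | hyp (α : Literal L A Empty) (hα : α ∈ N) : TSS.ClosedProvable P N α
  | step (r : Rule L A V) (hr : r ∈ P.rules) (σ : V → L.Term Empty)
      (above : ∀ β ∈ r.premises, TSS.ClosedProvable P N (β.subst σ)) :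
      TSS.ClosedProvable P N (r.conclusion.subst σ)

theorem TSS.ClosedProvable.mono {P : TSS L A V} {N M : Set (Literal L A Empty)} (h : N ⊆ M)
    {α : Literal L A Empty} (hα : P.ClosedProvable N α) : P.ClosedProvable M α := by
  induction hα with
  | hyp α hα => exact .hyp α (h hα)
  | step r hr σ _ ih => exact .step r hr σ ih

theorem TSS.ClosedProvable.provable {P : TSS L A V} {N : Set (Literal L A Empty)}
    {α : Literal L A Empty} (hα : P.ClosedProvable N α) :
    P.Provable (Literal.ofClosed V '' N) (α.ofClosed V) := by
  induction hα with
  | hyp α hα => exact .hyp _ ⟨α, hα, rfl⟩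
  | step r hr σ _ ih =>
    unfold Literal.ofClosed at ih ⊢
    rw [Literal.subst_subst]
    refine .step r hr _ fun β hβ => ?_
    rw [← Literal.subst_subst]
    exact ih β hβ

theorem TSS.Provable.closedProvable {P : TSS L A V} {H : Set (Literal L A V)}
    {α : Literal L A V} (hα : P.Provable H α) (τ : V → L.Term Empty) :
    P.ClosedProvable (Literal.subst τ '' H) (α.subst τ) := by
  induction hα with
  | hyp α hα => exact .hyp _ ⟨α, hα, rfl⟩
  | step r hr σ _ ih =>
    rw [Literal.subst_subst]
    refine .step r hr _ fun β hβ => ?_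
    rw [← Literal.subst_subst]
    exact ih β hβ

/-- The closed negative literals that no literal in `K` denies. -/
def undenied (K : Set (Literal L A Empty)) : Set (Literal L A Empty) :=
  {ν | ∃ t a, ν = .neg t a ∧ ∀ q, .pos t a q ∉ K}

theorem undenied_anti {K K' : Set (Literal L A Empty)} (h : K ⊆ K') :
    undenied K' ⊆ undenied K := by
  rintro _ ⟨t, a, rfl, hK⟩
  exact ⟨t, a, rfl, fun q hq => hK q (h hq)⟩

/-- A negative literal `neg p a` follows by negation as failure as soon as no transition `p --a-> q`
has a proof from the negative literals that no `κ ∈ K` denies: these form the largest set `N` of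
negative hypotheses which need not be refuted. -/
theorem TSS.wsProvable_neg_of_undenied {P : TSS L A V} {p : L.Term Empty} {a : A}
    (K : Set (Literal L A Empty)) (hK : ∀ κ ∈ K, P.WSProvable κ)
    (h : ∀ q, ¬ P.ClosedProvable (undenied K) (.pos p a q)) : P.WSProvable (.neg p a) := by
  refine .naf _ trivial K hK fun N hN γ hγ hp => ?_
  by_contra hcon
  push Not at hcon
  have hsub : N ⊆ undenied K := by
    intro ν hν
    cases ν with
    | pos t b t' => exact (hN _ hν).elim
    | neg t b => exact ⟨t, b, rfl, fun q hq => hcon _ hq _ hν ⟨rfl, rfl⟩⟩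
  cases γ with
  | neg t b => exact hγ
  | pos t b q =>
    obtain ⟨rfl, rfl⟩ := hγ
    -- substituting `t` for all variables turns the proof into a closed one
    have h1 := hp.closedProvable fun _ => t
    rw [Literal.subst_ofClosed, Set.image_image] at h1
    simp only [Literal.subst_ofClosed, Set.image_id'] at h1
    exact h q (h1.mono hsub)

/-- If `neg p a` follows by negation as failure from `K`, then no transition `p --a-> q` has a proof
from the negative literals that `K` leaves undenied. -/
theorem TSS.not_closedProvable_of_refutes {P : TSS L A V} {p : L.Term Empty} {a : A}
    {K : Set (Literal L A Empty)}
    (refutes : ∀ N : Set (Literal L A Empty), (∀ ν ∈ N, ν.IsNeg) →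
      ∀ γ : Literal L A Empty, γ.Denies (.neg p a) →
        P.Provable (Literal.ofClosed V '' N) (γ.ofClosed V) →
          ∃ κ ∈ K, ∃ ν ∈ N, κ.Denies ν) (q : L.Term Empty) :
    ¬ P.ClosedProvable (undenied K) (.pos p a q) := by
  intro h
  obtain ⟨κ, hκ, ν, hν, hd⟩ := refutes (undenied K)
    (by rintro _ ⟨t, b, rfl, -⟩; trivial) (.pos p a q) ⟨rfl, rfl⟩ h.provable
  obtain ⟨t, b, rfl, hK⟩ := hν
  cases κ with
  | pos t' b' q' =>
    obtain ⟨rfl, rfl⟩ := hd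
    exact hK q' hκ
  | neg t' b' => exact hd

theorem TSS.IsStandard.exists_pos {P : TSS L A V} (hstd : P.IsStandard) {r : Rule L A V}
    (hr : r ∈ P.rules) : ∃ s a v, r.conclusion = .pos s a v := by
  have h := hstd r hr
  cases hc : r.conclusion with
  | pos s a v => exact ⟨s, a, v, rfl⟩
  | neg s a => rw [hc] at h; exact h.elim

theorem TSS.IsStandard.mem_of_closedProvable_neg {P : TSS L A V} (hstd : P.IsStandard)
    {N : Set (Literal L A Empty)} {p : L.Term Empty} {a : A}
    (h : P.ClosedProvable N (.neg p a)) : .neg p a ∈ N := by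
  generalize hα : Literal.neg p a = α at h
  cases h with
  | hyp _ h => exact h
  | step r hr σ _ =>
    obtain ⟨s, b, v, hc⟩ := hstd.exists_pos hr
    rw [hc] at hα
    cases hα

theorem TSS.WSProvable.not_closedProvable {P : TSS L A V} (hstd : P.IsStandard)
    {p : L.Term Empty} {a : A} (h : P.WSProvable (.neg p a)) (q : L.Term Empty) :
    ¬ P.ClosedProvable (undenied {α | P.WSProvable α}) (.pos p a q) := by
  generalize hα : Literal.neg p a = α at h
  cases h with
  | step r hr σ _ =>
    obtain ⟨s, b, v, hc⟩ := hstd.exists_pos hr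
    rw [hc] at hα
    cases hα
  | naf _ _ K above refutes =>
    subst hα
    exact fun h => TSS.not_closedProvable_of_refutes refutes q (h.mono (undenied_anti above))

/-- Well-supported proofs of transitions in a standard TSS end with an instance of a rule, so that
one can argue by induction on them. -/
theorem TSS.WSProvable.pos_induction {P : TSS L A V} (hstd : P.IsStandard)
    {C : L.Term Empty → A → L.Term Empty → Prop}
    (step : ∀ r ∈ P.rules, ∀ s a v, r.conclusion = .pos s a v → ∀ σ : V → L.Term Empty,
      (∀ β ∈ r.premises, P.WSProvable (β.subst σ)) →
      (∀ t b u, .pos t b u ∈ r.premises → C (t.subst σ) b (u.subst σ)) →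
      C (s.subst σ) a (v.subst σ))
    {p : L.Term Empty} {a : A} {p' : L.Term Empty} (h : P.WSProvable (.pos p a p')) :
    C p a p' := by
  generalize hα : Literal.pos p a p' = α at h
  induction h generalizing p a p' with
  | step r hr σ above ih =>
    obtain ⟨s, b, v, hc⟩ := hstd.exists_pos hr
    rw [hc] at hα
    simp only [Literal.subst, Literal.pos.injEq] at hα
    obtain ⟨rfl, rfl, rfl⟩ := hα
    exact step r hr s _ v hc σ above fun t b u hβ => ih _ hβ rfl
  | naf β hβ => subst hα; exact hβ.elim

/-! ### Applying rules without lookahead -/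

/-- `y` is the right-hand side of a premise. -/
def Rule.IsRhs (r : Rule L A V) (y : V) : Prop :=
  ∃ β ∈ r.premises, β.HasRhs (var y)

theorem Rule.isNtytt {r : Rule L A V} (h : r.IsNtyft ∨ r.IsNtyxt) : r.IsNtytt :=
  h.elim (·.1) (·.1)

theorem Rule.IsNtytt.exists_var {r : Rule L A V} (h : r.IsNtytt) {t u : L.Term V} {b : A}
    (hβ : .pos t b u ∈ r.premises) : ∃ y, u = var y :=
  h.1 _ hβ u rfl

theorem Rule.NoLookahead.not_occurs {r : Rule L A V} (h : r.NoLookahead) {y : V} (hy : r.IsRhs y)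
    {β : Literal L A V} (hβ : β ∈ r.premises) : ¬ Occurs y β.lhs := by
  obtain ⟨β', hβ', hr⟩ := hy
  exact h β' hβ' _ hr y (occurs_var.2 rfl) β hβ

/-- In the absence of lookahead, the premises of a rule can be satisfied independently of each
other: their left-hand sides are fixed by `θ`, and any values found for the right-hand sides can be
used in the target. -/
theorem Rule.exists_instance {r : Rule L A V} (htt : r.IsNtytt) (hla : r.NoLookahead)
    {s v : L.Term V} {a : A} (hc : r.conclusion = .pos s a v) {Q : Literal L A Empty → Prop}
    (hQ : ∀ σ : V → L.Term Empty, (∀ β ∈ r.premises, Q (β.subst σ)) → Q (r.conclusion.subst σ))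
    (θ : V → L.Term Empty) (G : V → L.Term Empty → Prop)
    (hneg : ∀ t b, .neg t b ∈ r.premises → Q (.neg (t.subst θ) b))
    (hpos : ∀ t b y, .pos t b (var y) ∈ r.premises → ∃ q, Q (.pos (t.subst θ) b q) ∧ G y q) :
    ∃ θ', Q (.pos (s.subst θ) a (v.subst θ')) ∧ (∀ y, ¬ r.IsRhs y → θ' y = θ y) ∧
      ∀ y, r.IsRhs y → G y (θ' y) := by
  classical
  have hex : ∀ y, r.IsRhs y → ∃ q, (∀ t b, .pos t b (var y) ∈ r.premises →
      Q (.pos (t.subst θ) b q)) ∧ G y q := by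
    rintro y ⟨β, hβ, hr⟩
    cases β with
    | neg t b => exact hr.elim
    | pos t b u =>
      obtain rfl : u = var y := hr
      obtain ⟨q, h1, h2⟩ := hpos t b y hβ
      refine ⟨q, fun t' b' hβ' => ?_, h2⟩
      have := htt.2.1 _ hβ _ hβ' (var y) rfl rfl
      simp only [Literal.pos.injEq] at this
      obtain ⟨rfl, rfl, -⟩ := this
      exact h1
  have : Nonempty (L.Term Empty) := ⟨s.subst θ⟩
  choose! g hg using hex
  let θ' : V → L.Term Empty := fun y => if r.IsRhs y then g y else θ y
  have hoff : ∀ y, ¬ r.IsRhs y → θ' y = θ y := fun y hy => if_neg hy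
  have hon : ∀ y, r.IsRhs y → θ' y = g y := fun y hy => if_pos hy
  have hlhs : ∀ β ∈ r.premises, β.lhs.subst θ' = β.lhs.subst θ := fun β hβ =>
    subst_congr fun x hx => hoff x fun hy => hla.not_occurs hy hβ hx
  have hsrc : s.subst θ' = s.subst θ := subst_congr fun x hx => hoff x fun ⟨β, hβ, hr⟩ =>
    htt.2.2 β hβ x hr (by rw [Rule.source, hc]; exact hx)
  refine ⟨θ', ?_, hoff, fun y hy => ?_⟩
  · have := hQ θ' fun β hβ => ?_
    · rw [hc] at this
      rw [← hsrc]
      exact this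
    · have hl := hlhs β hβ
      cases β with
      | neg t b =>
        simp only [Literal.subst, Literal.lhs] at hl ⊢
        rw [hl]
        exact hneg t b hβ
      | pos t b u =>
        obtain ⟨y, rfl⟩ := htt.exists_var hβ
        have hy : r.IsRhs y := ⟨_, hβ, rfl⟩
        simp only [Literal.subst, Literal.lhs, FirstOrder.Language.Term.subst] at hl ⊢
        rw [hl, hon y hy]
        exact (hg y hy).1 t b hβ
  · rw [hon y hy]
    exact (hg y hy).2

/-- A version of `Rule.exists_instance` that fixes the target: right-hand sides that do not occur
in the target may be chosen anew. -/
theorem Rule.instance_of_polled {r : Rule L A V} (htt : r.IsNtytt) (hla : r.NoLookahead)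
    {s v : L.Term V} {a : A} (hc : r.conclusion = .pos s a v) {Q : Literal L A Empty → Prop}
    (hQ : ∀ σ : V → L.Term Empty, (∀ β ∈ r.premises, Q (β.subst σ)) → Q (r.conclusion.subst σ))
    (θ : V → L.Term Empty)
    (hneg : ∀ t b, .neg t b ∈ r.premises → Q (.neg (t.subst θ) b))
    (hpos : ∀ t b y, .pos t b (var y) ∈ r.premises → Occurs y v → Q (.pos (t.subst θ) b (θ y)))
    (hpoll : ∀ t b y, .pos t b (var y) ∈ r.premises → ¬ Occurs y v →
      ∃ q, Q (.pos (t.subst θ) b q)) :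
    Q (.pos (s.subst θ) a (v.subst θ)) := by
  obtain ⟨θ', h, hoff, hon⟩ := Rule.exists_instance htt hla hc hQ θ
    (fun y q => Occurs y v → q = θ y) hneg fun t b y hβ => by
      by_cases hy : Occurs y v
      · exact ⟨_, hpos t b y hβ hy, fun _ => rfl⟩
      · obtain ⟨q, hq⟩ := hpoll t b y hβ hy
        exact ⟨q, hq, fun h => (hy h).elim⟩
  have : v.subst θ' = v.subst θ := subst_congr fun y hy => by
    by_cases hr : r.IsRhs y
    · exact hon y hr hy
    · exact hoff y hr
  rwa [this] at h

/-! ### Congruence closures -/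

/-- The closure of a relation on closed terms under all function symbols. -/
inductive CongrClosure (R : L.Term Empty → L.Term Empty → Prop) :
    L.Term Empty → L.Term Empty → Prop
  | base {p q : L.Term Empty} (h : R p q) : CongrClosure R p q
  | func {n : ℕ} (f : L.Functions n) (p q : Fin n → L.Term Empty)
      (h : ∀ i, CongrClosure R (p i) (q i)) : CongrClosure R (func f p) (func f q)

theorem CongrClosure.mono {R S : L.Term Empty → L.Term Empty → Prop} (h : ∀ p q, R p q → S p q)
    {p q : L.Term Empty} (hpq : CongrClosure R p q) : CongrClosure S p q := by
  induction hpq with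
  | base hb => exact .base (h _ _ hb)
  | func f p q _ ih => exact .func f p q ih

theorem CongrClosure.subst {R : L.Term Empty → L.Term Empty → Prop} {σ τ : V → L.Term Empty}
    {t : L.Term V} (h : ∀ x, Occurs x t → CongrClosure R (σ x) (τ x)) :
    CongrClosure R (t.subst σ) (t.subst τ) := by
  induction t with
  | var y => exact h y (occurs_var.2 rfl)
  | func f ts ih => exact .func f _ _ fun i => ih i fun x hx => h x (occurs_func.2 ⟨i, hx⟩)

theorem CongrClosure.of_swap {R : L.Term Empty → L.Term Empty → Prop} {p q : L.Term Empty}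
    (h : CongrClosure (Function.swap R) q p) : CongrClosure R p q := by
  induction h with
  | base h => exact .base h
  | func f p q _ ih => exact .func f q p ih

/-- The sources `x` and `f(x₁,…,xₙ)` cannot inspect the structure of the arguments: if `p` matches
such a source, then so does any term that is related to `p` by applications of function symbols. -/
theorem Rule.exists_subst_of_congrClosure {r : Rule L A V} (hr : r.IsNtyft ∨ r.IsNtyxt)
    {R : L.Term Empty → L.Term Empty → Prop} (hR : ∀ p, R p p) {s : L.Term V} (hs : r.source = s)
    {σ : V → L.Term Empty} {q : L.Term Empty} (h : CongrClosure R (s.subst σ) q) :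
    R (s.subst σ) q ∨ ∃ σ' : V → L.Term Empty, s.subst σ' = q ∧
      ∀ x, CongrClosure R (σ x) (σ' x) := by
  classical
  subst hs
  rcases hr with ⟨-, n, f, x, hx, hs⟩ | ⟨-, x, hs⟩
  · rw [hs] at h ⊢
    simp only [FirstOrder.Language.Term.subst] at h ⊢
    generalize hp : (FirstOrder.Language.Term.func f fun i => σ (x i)) = p at h
    cases h with
    | base h => exact .inl h
    | func g ps qs h =>
      right
      obtain ⟨rfl, hg, hps⟩ := FirstOrder.Language.Term.func.inj hp
      obtain rfl := eq_of_heq hg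
      obtain rfl := eq_of_heq hps
      refine ⟨Function.extend x qs σ, ?_, fun z => ?_⟩
      · congr 1
        funext i
        exact hx.extend_apply _ _ i
      · by_cases hz : ∃ i, x i = z
        · obtain ⟨i, rfl⟩ := hz
          rw [hx.extend_apply]
          exact h i
        · rw [Function.extend_apply' _ _ _ hz]
          exact .base (hR _)
  · rw [hs] at h ⊢
    refine .inr ⟨Function.update σ x q, by simp, fun z => ?_⟩
    by_cases hz : z = x
    · subst hz
      simpa using h
    · rw [Function.update_of_ne hz]
      exact .base (hR _)

/-! ### Initial actions and refusals -/

/-- All initial actions and all refusals of `p` are initial actions and refusals of `q`. -/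
def TSS.InitialLE (P : TSS L A V) (p q : L.Term Empty) : Prop :=
  (∀ a, (∃ p', P.WSProvable (.pos p a p')) → ∃ q', P.WSProvable (.pos q a q')) ∧
  ∀ a, P.WSProvable (.neg p a) → P.WSProvable (.neg q a)

theorem TSS.InitialLE.refl (P : TSS L A V) (p : L.Term Empty) : P.InitialLE p p :=
  ⟨fun _ => id, fun _ => id⟩

/-- The part of `TSS.initialLE_of_congrClosure` about refusals.  A proof of a transition of `q` from
negative literals that are not refuted is turned, rule by rule, into a proof of a transition of `p`
from negative literals that are not denied in `K`. -/
theorem TSS.exists_closedProvable_of_congrClosure {P : TSS L A V} (hstd : P.IsStandard)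
    (hft : P.IsNtyftNtyxt) (hla : ∀ r ∈ P.rules, r.NoLookahead)
    {K : Set (Literal L A Empty)} (hK : ∀ κ ∈ K, P.WSProvable κ)
    (hKR : ∀ t b t', .pos t b t' ∈ K → ∀ q, CongrClosure P.InitialLE t q →
      ∃ q', P.WSProvable (.pos q b q'))
    {q : L.Term Empty} {a : A} {q' : L.Term Empty}
    (h : P.ClosedProvable (undenied {α | P.WSProvable α}) (.pos q a q'))
    {p : L.Term Empty} (hpq : CongrClosure (Function.swap P.InitialLE) q p) :
    ∃ p', P.ClosedProvable (undenied K) (.pos p a p') := by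
  generalize hα : Literal.pos q a q' = α at h
  induction h generalizing p q a q' with
  | hyp α hN =>
    obtain ⟨t, b, rfl, -⟩ := hN
    cases hα
  | step r hr σ above ih =>
    obtain ⟨s, b, v, hc⟩ := hstd.exists_pos hr
    have hroot := TSS.ClosedProvable.step r hr σ above
    rw [hc] at hα hroot
    simp only [Literal.subst, Literal.pos.injEq] at hα hroot
    obtain ⟨rfl, rfl, rfl⟩ := hα
    have hs : r.source = s := by rw [Rule.source, hc]; rfl
    obtain hb | ⟨τ, rfl, hτ⟩ := Rule.exists_subst_of_congrClosure (hft r hr)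
      (R := Function.swap P.InitialLE) (fun p => TSS.InitialLE.refl P p) hs hpq
    · by_contra! hcon
      exact (hb.2 _ (wsProvable_neg_of_undenied K hK hcon)).not_closedProvable hstd _ hroot
    · have hsubst : ∀ t : L.Term V,
          CongrClosure (Function.swap P.InitialLE) (t.subst σ) (t.subst τ) :=
        fun t => .subst fun x _ => hτ x
      obtain ⟨θ, hθ, -⟩ := Rule.exists_instance (Rule.isNtytt (hft r hr)) (hla r hr) hc
        (fun σ => TSS.ClosedProvable.step (N := undenied K) r hr σ) τ (fun _ _ => True)
        (fun t b hβ => by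
          obtain ⟨_, _, he, hN⟩ := hstd.mem_of_closedProvable_neg (above _ hβ)
          cases he
          refine .hyp _ ⟨_, _, rfl, fun q hq => ?_⟩
          obtain ⟨q', hq'⟩ := hKR _ _ _ hq _ (hsubst t).of_swap
          exact hN q' hq')
        (fun t b y hβ => (ih _ hβ (hsubst t) rfl).imp fun _ h => ⟨h, trivial⟩)
      exact ⟨_, hθ⟩

/-- In the absence of lookahead, the initial actions and the refusals of a term depend
monotonically on those of its subterms. -/
theorem TSS.WSProvable.initial_of_congrClosure {P : TSS L A V} (hstd : P.IsStandard)
    (hft : P.IsNtyftNtyxt) (hla : ∀ r ∈ P.rules, r.NoLookahead) {α : Literal L A Empty}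
    (h : P.WSProvable α) :
    (∀ p a p', α = .pos p a p' → ∀ q, CongrClosure P.InitialLE p q →
      ∃ q', P.WSProvable (.pos q a q')) ∧
    (∀ p a, α = .neg p a → ∀ q, CongrClosure P.InitialLE p q → P.WSProvable (.neg q a)) := by
  induction h with
  | step r hr σ above ih =>
    obtain ⟨s, a, v, hc⟩ := hstd.exists_pos hr
    have hroot := TSS.WSProvable.step r hr σ above
    rw [hc] at hroot ⊢
    refine ⟨?_, fun p a h => by cases h⟩
    rintro _ _ _ ⟨⟩ q hpq
    obtain hb | ⟨τ, rfl, hτ⟩ := Rule.exists_subst_of_congrClosure (hft r hr)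
      (TSS.InitialLE.refl P) (show r.source = s by rw [Rule.source, hc]; rfl) hpq
    · exact hb.1 a ⟨_, hroot⟩
    · have hsubst : ∀ t : L.Term V, CongrClosure P.InitialLE (t.subst σ) (t.subst τ) :=
        fun t => .subst fun x _ => hτ x
      obtain ⟨θ, hθ, -⟩ := Rule.exists_instance (Rule.isNtytt (hft r hr)) (hla r hr) hc
        (fun σ => TSS.WSProvable.step r hr σ) τ (fun _ _ => True)
        (fun t b hβ => (ih _ hβ).2 _ _ rfl _ (hsubst t))
        (fun t b y hβ => ((ih _ hβ).1 _ _ _ rfl _ (hsubst t)).imp fun _ h => ⟨h, trivial⟩)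
      exact ⟨_, hθ⟩
  | naf β hβ K above refutes ih =>
    refine ⟨by rintro p a p' rfl; exact hβ.elim, ?_⟩
    rintro p a rfl q hpq
    refine wsProvable_neg_of_undenied _ (fun κ hκ => hκ) fun q' hq' => ?_
    obtain ⟨p', hp'⟩ := exists_closedProvable_of_congrClosure hstd hft hla above
      (fun t b t' hκ => (ih _ hκ).1 t b t' rfl) hq' (CongrClosure.of_swap hpq)
    exact not_closedProvable_of_refutes refutes p' hp'

theorem TSS.initialLE_of_congrClosure {P : TSS L A V} (hstd : P.IsStandard)
    (hft : P.IsNtyftNtyxt) (hla : ∀ r ∈ P.rules, r.NoLookahead) {p q : L.Term Empty}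
    (h : CongrClosure P.InitialLE p q) : P.InitialLE p q :=
  ⟨fun _ ⟨_, hp⟩ => (hp.initial_of_congrClosure hstd hft hla).1 _ _ _ rfl _ h,
    fun _ hp => (hp.initial_of_congrClosure hstd hft hla).2 _ _ rfl _ h⟩

/-! ### Liquid contexts -/

/-- Closed contexts with exactly one hole, which is at a `Λ`-liquid position, as functions on closed
terms. -/
inductive LiquidContext (Λ : ArgPred L) : (L.Term Empty → L.Term Empty) → Prop
  | id : LiquidContext Λ fun p => p
  | arg {n : ℕ} (f : L.Functions n) (i : Fin n) (ps : Fin n → L.Term Empty)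
      (D : L.Term Empty → L.Term Empty) (hi : Λ f i) (hD : LiquidContext Λ D) :
      LiquidContext Λ fun p => func f (Function.update ps i (D p))

theorem LiquidContext.comp {Λ : ArgPred L} {D E : L.Term Empty → L.Term Empty}
    (hD : LiquidContext Λ D) (hE : LiquidContext Λ E) : LiquidContext Λ fun p => D (E p) := by
  induction hD with
  | id => exact hE
  | arg f i ps D hi _ ih => exact .arg f i ps _ hi ih

theorem LiquidContext.congrClosure {Λ : ArgPred L} {D : L.Term Empty → L.Term Empty}
    (hD : LiquidContext Λ D) {R : L.Term Empty → L.Term Empty → Prop} (hR : ∀ p, R p p)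
    {p q : L.Term Empty} (h : CongrClosure R p q) : CongrClosure R (D p) (D q) := by
  induction hD with
  | id => exact h
  | arg f i ps D _ _ ih =>
    refine .func f _ _ fun j => ?_
    by_cases hj : j = i
    · subst hj
      simpa using ih
    · rw [Function.update_of_ne hj, Function.update_of_ne hj]
      exact .base (hR _)

/-- A closed instance of a term is a liquid context in a variable that occurs exactly once, at a
liquid position. -/
theorem LiquidContext.subst [DecidableEq V] {Λ : ArgPred L} {D : L.Term Empty → L.Term Empty}
    (hD : LiquidContext Λ D) {x : V} (σ : V → L.Term Empty) {t : L.Term V} (hx : Occurs x t)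
    (huniq : ∀ π π', OccursAt x t π → OccursAt x t π' → π = π')
    (hliq : ∀ π, OccursAt x t π → LiquidAt Λ t π) :
    LiquidContext Λ fun p => t.subst (Function.update σ x (D p)) := by
  induction t with
  | var y =>
    obtain rfl := occurs_var.1 hx
    simpa [FirstOrder.Language.Term.subst] using hD
  | func f ts ih =>
    obtain ⟨i, π, hπ⟩ := occurs_func.1 hx
    have hat : ∀ j π, OccursAt x (ts j) π → OccursAt x (func f ts) ((j : ℕ) :: π) :=
      fun j π h => ⟨j, rfl, h⟩
    have hli : ∀ j π, OccursAt x (ts j) π → Λ f j ∧ LiquidAt Λ (ts j) π := by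
      intro j π h
      obtain ⟨k, hk, h1, h2⟩ := hliq _ (hat j π h)
      obtain rfl := Fin.ext hk
      exact ⟨h1, h2⟩
    have hne : ∀ j, j ≠ i → ¬ Occurs x (ts j) := by
      rintro j hj ⟨π', hπ'⟩
      have := huniq _ _ (hat j π' hπ') (hat i π hπ)
      exact hj (Fin.ext (List.cons.inj this).1)
    have := LiquidContext.arg f i (fun j => (ts j).subst σ) _ (hli i π hπ).1
      (ih i ⟨π, hπ⟩ (fun π π' h h' => (List.cons.inj (huniq _ _ (hat i π h) (hat i π' h'))).2)
        fun π h => (hli i π h).2)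
    convert this using 2 with p
    simp only [FirstOrder.Language.Term.subst]
    congr 1
    funext j
    by_cases hj : j = i
    · subst hj; simp
    · rw [Function.update_of_ne hj, subst_update_of_not_occurs (hne j hj)]

/-- If an instance of the source of an ntyft or ntyxt rule has a liquid hole, and the context is not
trivial, then the hole is inside the value of a single floating variable of the source. -/
theorem Rule.exists_floating_of_liquidContext [DecidableEq V] {Λ : ArgPred L} {r : Rule L A V}
    (hr : r.IsNtyft ∨ r.IsNtyxt) {s : L.Term V} (hs : r.source = s) {σ : V → L.Term Empty}
    {n : ℕ} (f : L.Functions n) (i : Fin n) (ps : Fin n → L.Term Empty)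
    {D : L.Term Empty → L.Term Empty} (hi : Λ f i) (hD : LiquidContext Λ D) {p : L.Term Empty}
    (h : s.subst σ = func f (Function.update ps i (D p))) :
    ∃ x E, Occurs x s ∧ r.Floating Λ x ∧ LiquidContext Λ E ∧ σ x = E p ∧
      ∀ q, s.subst (Function.update σ x (E q)) = func f (Function.update ps i (D q)) := by
  subst hs
  rcases hr with ⟨-, m, g, x, hx, hs⟩ | ⟨-, x, hs⟩
  · rw [hs] at h
    obtain ⟨rfl, hg, hps⟩ := FirstOrder.Language.Term.func.inj h
    obtain rfl := eq_of_heq hg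
    have hps := fun j => congrFun (eq_of_heq hps) j
    simp only [FirstOrder.Language.Term.subst] at hps
    refine ⟨x i, D, ?_, .inr ⟨[(i : ℕ)], ?_, ?_, ?_⟩, hD, by simpa using hps i, fun q => ?_⟩
    · rw [hs]
      exact occurs_func.2 ⟨i, occurs_var.2 rfl⟩
    · rw [hs]
      exact ⟨i, rfl, rfl, rfl⟩
    · rw [hs]
      rintro (_ | ⟨k, π⟩) hπ
      · exact hπ.elim
      · obtain ⟨j, rfl, hj, rfl⟩ := hπ
        rw [hx hj]
    · rw [hs]
      exact ⟨i, rfl, hi, trivial⟩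
    · rw [hs]
      simp only [FirstOrder.Language.Term.subst]
      congr 1
      funext j
      by_cases hj : j = i
      · subst hj; simp
      · rw [Function.update_of_ne (hx.ne hj), Function.update_of_ne hj, hps j,
          Function.update_of_ne hj]
  · rw [hs] at h
    refine ⟨x, _, ?_, .inr ⟨[], ?_, ?_, ?_⟩, .arg f i ps D hi hD, h, fun q => ?_⟩
    · rw [hs]
      exact occurs_var.2 rfl
    · rw [hs]
      exact ⟨rfl, rfl⟩
    · rw [hs]
      exact fun π hπ => hπ.2
    · rw [hs]
      trivial
    · rw [hs]
      simp [FirstOrder.Language.Term.subst]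

/-! ### Occurrences in readiness safe rules -/

theorem Rule.propagatedAt_target {r : Rule L A V} {s v : L.Term V} {a : A}
    (hc : r.conclusion = .pos s a v) {x : V} {π : List ℕ} (h : OccursAt x v π) :
    r.PropagatedAt x .target v π :=
  ⟨by simp only [TermAt]; rw [hc]; rfl, h, trivial⟩

theorem Rule.propagatedAt_premise {r : Rule L A V} {s v : L.Term V} {a : A}
    (hc : r.conclusion = .pos s a v) {t : L.Term V} {b : A} {y : V}
    (hβ : .pos t b (var y) ∈ r.premises) (hy : Occurs y v) {x : V} {π : List ℕ}
    (h : OccursAt x t π) : r.PropagatedAt x (.premise (.pos t b (var y))) t π :=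
  ⟨⟨hβ, rfl⟩, h, y, rfl, v, by rw [hc]; rfl, hy⟩

/-- A floating variable that occurs in the target yields a liquid context in the target. -/
theorem Rule.ReadyTraceSafe.liquidContext_target [DecidableEq V] {Λ : ArgPred L} {r : Rule L A V}
    (hr : r.ReadyTraceSafe Λ) {s v : L.Term V} {a : A} (hc : r.conclusion = .pos s a v) {x : V}
    (hx : r.Floating Λ x) (hxv : Occurs x v) (σ : V → L.Term Empty)
    {D : L.Term Empty → L.Term Empty} (hD : LiquidContext Λ D) :
    LiquidContext Λ fun p => v.subst (Function.update σ x (D p)) :=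
  hD.subst σ hxv
    (fun _ _ h h' => ((hr.2 x hx).1 _ _ _ _ _ _ (propagatedAt_target hc h)
      (propagatedAt_target hc h')).2)
    fun _ h => (hr.2 x hx).2 _ _ _ (propagatedAt_target hc h)

theorem Rule.ReadyTraceSafe.liquidContext_premise [DecidableEq V] {Λ : ArgPred L} {r : Rule L A V}
    (hr : r.ReadyTraceSafe Λ) {s v : L.Term V} {a : A} (hc : r.conclusion = .pos s a v) {x : V}
    (hx : r.Floating Λ x) {t : L.Term V} {b : A} {y : V} (hβ : .pos t b (var y) ∈ r.premises)
    (hy : Occurs y v) (hxt : Occurs x t) (σ : V → L.Term Empty)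
    {D : L.Term Empty → L.Term Empty} (hD : LiquidContext Λ D) :
    LiquidContext Λ fun p => t.subst (Function.update σ x (D p)) :=
  hD.subst σ hxt
    (fun _ _ h h' => ((hr.2 x hx).1 _ _ _ _ _ _ (propagatedAt_premise hc hβ hy h)
      (propagatedAt_premise hc hβ hy h')).2)
    fun _ h => (hr.2 x hx).2 _ _ _ (propagatedAt_premise hc hβ hy h)

/-- If a floating variable has a propagated occurrence, then it occurs in no premise other than the
one that may contain this occurrence. -/
theorem Rule.ReadinessSafe.not_occurs_lhs {Λ : ArgPred L} {r : Rule L A V}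
    (hr : r.ReadinessSafe Λ) {x : V} (hx : r.Floating Λ x) {pl : Place L A V} {t : L.Term V}
    {π : List ℕ} (hp : r.PropagatedAt x pl t π) {β : Literal L A V} (hβ : β ∈ r.premises)
    (hne : pl ≠ .premise β) : ¬ Occurs x β.lhs := by
  rintro ⟨π', hπ'⟩
  by_cases h : r.RhsInTarget β
  · exact hne ((hr.1.2 x hx).1 _ _ _ _ _ _ hp
      (show r.PropagatedAt x (.premise β) β.lhs π' from ⟨⟨hβ, rfl⟩, hπ', h⟩)).1
  · exact hr.2 x hx ⟨⟨_, _, _, hp⟩, ⟨.premise β, β.lhs, π', ⟨hβ, rfl⟩, hπ', h⟩⟩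

/-! ### Transitions of a liquid context -/

/-- The three ways in which a transition `D p --a-> q` of a context can depend on the process `p` in
the hole: `p` is passed on unchanged, a transition of `p` is used and its target is passed on, or
only the initial actions and refusals of `p` matter. -/
inductive TSS.ContextStep (P : TSS L A V) (Λ : ArgPred L) (D : L.Term Empty → L.Term Empty)
    (p : L.Term Empty) (a : A) : L.Term Empty → Prop
  | keep (E : L.Term Empty → L.Term Empty) (hE : LiquidContext Λ E)
      (h : ∀ q, P.WSProvable (.pos (D q) a (E q))) : ContextStep P Λ D p a (E p)
  | move (E : L.Term Empty → L.Term Empty) (hE : LiquidContext Λ E) (b : A) (p' : L.Term Empty)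
      (hp : P.WSProvable (.pos p b p'))
      (h : ∀ q q', P.WSProvable (.pos q b q') → P.WSProvable (.pos (D q) a (E q'))) :
      ContextStep P Λ D p a (E p')
  | poll (u : L.Term Empty) (h : ∀ q, P.InitialLE p q → P.WSProvable (.pos (D q) a u)) :
      ContextStep P Λ D p a u

theorem TSS.WSProvable.contextStep {P : TSS L A V} (hstd : P.IsStandard)
    (hft : P.IsNtyftNtyxt) {Λ : ArgPred L} (hsafe : ∀ r ∈ P.rules, r.ReadinessSafe Λ)
    {p₀ : L.Term Empty} {a : A} {u : L.Term Empty} (h : P.WSProvable (.pos p₀ a u)) :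
    ∀ (D : L.Term Empty → L.Term Empty), LiquidContext Λ D → ∀ p, p₀ = D p →
      P.ContextStep Λ D p a u := by
  classical
  have hla : ∀ r ∈ P.rules, r.NoLookahead := fun r hr => (hsafe r hr).1.1
  have hroot := h
  revert hroot
  refine h.pos_induction hstd (C := fun p₀ a u => P.WSProvable (.pos p₀ a u) →
    ∀ D, LiquidContext Λ D → ∀ p, p₀ = D p → P.ContextStep Λ D p a u) ?_
  intro r hr s a v hc σ above ih hroot D hD p hDp
  cases hD with
  | id => rw [hDp] at hroot; exact .move _ .id a _ hroot fun _ _ h => h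
  | arg f i ps D hi hD =>
    have htt : r.IsNtytt := Rule.isNtytt (hft r hr)
    have hs : r.source = s := by rw [Rule.source, hc]; rfl
    obtain ⟨x, E, hxs, hx, hE, hσx, hsub⟩ :=
      Rule.exists_floating_of_liquidContext (hft r hr) hs f i ps hi hD hDp
    have hσ : Function.update σ x (E p) = σ := by rw [← hσx, Function.update_eq_self]
    -- `x` occurs in the source, so it is not the right-hand side of a premise
    have hne : ∀ {t b y}, .pos t b (var y) ∈ r.premises → y ≠ x := by
      rintro t b y hβ rfl
      exact htt.2.2 _ hβ y rfl (hs ▸ hxs)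
    have hfire : ∀ σ : V → L.Term Empty, (∀ β ∈ r.premises, P.WSProvable (β.subst σ)) →
      P.WSProvable (r.conclusion.subst σ) := fun σ => .step r hr σ
    have hsubst : ∀ q, P.InitialLE p q → ∀ t : L.Term V,
        CongrClosure P.InitialLE (t.subst σ) (t.subst (Function.update σ x (E q))) := by
      intro q hq t
      refine .subst fun z _ => ?_
      by_cases hz : z = x
      · subst hz
        rw [hσx, Function.update_self]
        exact hE.congrClosure (InitialLE.refl P) (.base hq)
      · rw [Function.update_of_ne hz]
        exact .base (.refl P _)
    by_cases htgt : Occurs x v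
    · -- `x` occurs in the target, hence in no premise
      obtain ⟨π, hπ⟩ := htgt
      have hno : ∀ β ∈ r.premises, ¬ Occurs x β.lhs := fun β hβ =>
        (hsafe r hr).not_occurs_lhs hx (Rule.propagatedAt_target hc hπ) hβ (by simp)
      have hstep := TSS.ContextStep.keep (P := P) (D := fun p => func f (Function.update ps i (D p)))
        (p := p) (a := a) _
        ((hsafe r hr).1.liquidContext_target hc hx ⟨π, hπ⟩ σ hE) fun q => by
          rw [← hsub q]
          refine Rule.instance_of_polled htt (hla r hr) hc hfire _ (fun t b hβ => ?_)
            (fun t b y hβ _ => ?_) (fun t b y hβ _ => ⟨σ y, ?_⟩)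
          · rw [subst_update_of_not_occurs (show ¬ Occurs x t from hno _ hβ)]
            exact above _ hβ
          · rw [subst_update_of_not_occurs (show ¬ Occurs x t from hno _ hβ),
              Function.update_of_ne (hne hβ)]
            exact above _ hβ
          · rw [subst_update_of_not_occurs (show ¬ Occurs x t from hno _ hβ)]
            exact above _ hβ
      rwa [hσ] at hstep
    -- otherwise `x` may be propagated through a premise whose right-hand side `y` is in the target
    by_cases hprem : ∃ t b y, .pos t b (var y) ∈ r.premises ∧ Occurs y v ∧ Occurs x t
    · obtain ⟨t, b, y, hβ, hy, hxt⟩ := hprem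
      obtain ⟨π, hπ⟩ := hxt
      have hyx : y ≠ x := hne hβ
      have hyfl : r.Floating Λ y := .inl ⟨_, hβ, rfl⟩
      have hyrhs : r.IsRhs y := ⟨_, hβ, rfl⟩
      have hno : ∀ β ∈ r.premises, β ≠ .pos t b (var y) → ¬ Occurs x β.lhs := fun β hβ' hne' =>
        (hsafe r hr).not_occurs_lhs hx (Rule.propagatedAt_premise hc hβ hy hπ) hβ'
          (by simpa using hne'.symm)
      have hstep := ih t b (var y) hβ (above _ hβ)
        (fun q => t.subst (Function.update σ x (E q)))
        ((hsafe r hr).1.liquidContext_premise hc hx hβ hy ⟨π, hπ⟩ σ hE) p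
        (by rw [hσ])
      -- firing the rule with values `E q` for `x` and `w` for `y`
      have key : ∀ q w, P.WSProvable (.pos (t.subst (Function.update σ x (E q))) b w) →
          P.WSProvable (.pos (func f (Function.update ps i (D q))) a
            (v.subst (Function.update σ y w))) := by
        intro q w hw
        have hagree : ∀ β ∈ r.premises,
            β.lhs.subst (Function.update (Function.update σ x (E q)) y w) =
            β.lhs.subst (Function.update σ x (E q)) := fun β hβ' =>
          subst_update_of_not_occurs ((hla r hr).not_occurs hyrhs hβ') _
        have hsrc : s.subst (Function.update (Function.update σ x (E q)) y w)
            = s.subst (Function.update σ x (E q)) :=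
          subst_update_of_not_occurs (by rw [← hs]; exact htt.2.2 _ hβ y rfl) _
        have htgt' : v.subst (Function.update (Function.update σ x (E q)) y w)
            = v.subst (Function.update σ y w) := by
          rw [Function.update_comm hyx.symm, subst_update_of_not_occurs htgt]
        have hpos : ∀ t' b' y', .pos t' b' (var y') ∈ r.premises → P.WSProvable
            (.pos (t'.subst (Function.update (Function.update σ x (E q)) y w)) b'
              (Function.update (Function.update σ x (E q)) y w y')) := by
          intro t' b' y' hβ'
          rw [show t'.subst _ = t'.subst _ from hagree _ hβ']
          by_cases hyy : y' = y
          · subst hyy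
            have := htt.2.1 _ hβ _ hβ' (var y') rfl rfl
            cases this
            simpa using hw
          · rw [Function.update_of_ne hyy, Function.update_of_ne (hne hβ'),
              subst_update_of_not_occurs
                (show ¬ Occurs x t' from hno _ hβ' (by rintro ⟨⟩; exact hyy rfl))]
            exact above _ hβ'
        rw [← hsub q, ← hsrc, ← htgt']
        refine Rule.instance_of_polled htt (hla r hr) hc hfire _ (fun t' b' hβ' => ?_)
          (fun t' b' y' hβ' _ => hpos t' b' y' hβ') (fun t' b' y' hβ' _ => ⟨_, hpos t' b' y' hβ'⟩)
        rw [show t'.subst _ = t'.subst _ from hagree _ hβ',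
          subst_update_of_not_occurs (show ¬ Occurs x t' from hno _ hβ' (by rintro ⟨⟩))]
        exact above _ hβ'
      have hctx : ∀ {F : L.Term Empty → L.Term Empty}, LiquidContext Λ F →
          LiquidContext Λ fun q => v.subst (Function.update σ y (F q)) := fun hF =>
        (hsafe r hr).1.liquidContext_target hc hyfl hy σ hF
      have hσy : v.subst σ = v.subst (Function.update σ y (σ y)) := by
        rw [Function.update_eq_self]
      rw [hσy]
      simp only [FirstOrder.Language.Term.subst] at hstep
      generalize σ y = w at hstep
      cases hstep with
      | keep F hF h => exact .keep _ (hctx hF) fun q => key q _ (h q)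
      | move F hF c p' hp h => exact .move _ (hctx hF) c p' hp fun q q' hq => key q _ (h q q' hq)
      | poll _ h => exact .poll _ fun q hq => key q _ (h q hq)
    · -- all occurrences of `x` are polled
      push Not at hprem
      refine .poll _ fun q hpq => ?_
      rw [← hsub q, ← subst_update_of_not_occurs htgt (E q)]
      have hle := fun t => initialLE_of_congrClosure hstd hft hla (hsubst q hpq t)
      refine Rule.instance_of_polled htt (hla r hr) hc hfire _ (fun t b hβ => ?_)
        (fun t b y hβ hy => ?_) (fun t b y hβ _ => ?_)
      · exact (hle t).2 b (above _ hβ)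
      · rw [subst_update_of_not_occurs (hprem t b y hβ hy), Function.update_of_ne (hne hβ)]
        exact above _ hβ
      · exact (hle t).1 b ⟨_, above _ hβ⟩

/-! ### Observations of contexts and of congruent terms -/

/-- The observation of all initial actions and all refusals of `p`. -/
def TSS.readyObs (P : TSS L A V) (p : L.Term Empty) : Obs A :=
  (Obs.conj fun a : {a // P.WSProvable (.neg p a)} => Obs.refuse a.1).and
    (Obs.conj fun b : {b // ∃ p', P.WSProvable (.pos p b p')} => Obs.act b.1 Obs.top)

theorem TSS.isReadiness_readyObs (P : TSS L A V) (p : L.Term Empty) :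
    (P.readyObs p).IsReadiness :=
  .ready _ _

theorem TSS.sat_ready_iff {P : TSS L A V} {I J : Type u} {a : I → A} {b : J → A}
    {p : L.Term Empty} :
    P.Sat p ((Obs.conj fun i => Obs.refuse (a i)).and (Obs.conj fun j => Obs.act (b j) Obs.top)) ↔
      (∀ i, P.WSProvable (.neg p (a i))) ∧ ∀ j, ∃ p', P.WSProvable (.pos p (b j) p') := by
  simp [Obs.and, TSS.Sat, ULift.forall, and_comm]

theorem TSS.sat_readyObs_iff {P : TSS L A V} {p q : L.Term Empty} :
    P.Sat q (P.readyObs p) ↔ P.InitialLE p q := by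
  rw [readyObs, sat_ready_iff, InitialLE, and_comm]
  simp only [Subtype.forall]

theorem TSS.ReadinessLE.refl (P : TSS L A V) (p : L.Term Empty) : P.ReadinessLE p p :=
  fun _ => id

theorem TSS.ReadinessLE.initialLE {P : TSS L A V} {p q : L.Term Empty} (h : P.ReadinessLE p q) :
    P.InitialLE p q :=
  sat_readyObs_iff.1 (h ⟨P.isReadiness_readyObs p, sat_readyObs_iff.2 (.refl P p)⟩).2

/-- A readiness observation of a liquid context is guaranteed by a single readiness observation of
the process in the hole. -/
theorem TSS.exists_obs_of_liquidContext {P : TSS L A V} (hstd : P.IsStandard)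
    (hft : P.IsNtyftNtyxt) {Λ : ArgPred L} (hsafe : ∀ r ∈ P.rules, r.ReadinessSafe Λ) {φ : Obs A}
    (hφ : φ.IsReadiness) {D : L.Term Empty → L.Term Empty} (hD : LiquidContext Λ D)
    {p : L.Term Empty} (h : P.Sat (D p) φ) :
    ∃ ψ : Obs A, ψ.IsReadiness ∧ P.Sat p ψ ∧ ∀ q, P.Sat q ψ → P.Sat (D q) φ := by
  induction hφ generalizing D p with
  | top => exact ⟨.top, .top, trivial, fun _ _ => trivial⟩
  | ready a b =>
    refine ⟨P.readyObs p, P.isReadiness_readyObs p, sat_readyObs_iff.2 (.refl P p), fun q hq => ?_⟩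
    have hle := initialLE_of_congrClosure hstd hft (fun r hr => (hsafe r hr).1.1)
      (hD.congrClosure (InitialLE.refl P) (.base (sat_readyObs_iff.1 hq)))
    rw [sat_ready_iff] at h ⊢
    exact ⟨fun i => hle.2 _ (h.1 i), fun j => hle.1 _ (h.2 j)⟩
  | act a φ _ ih =>
    obtain ⟨u, hu, hφu⟩ := h
    cases hu.contextStep hstd hft hsafe D hD p rfl with
    | keep E hE h =>
      obtain ⟨ψ, hψ, hp, hE'⟩ := ih hE hφu
      exact ⟨ψ, hψ, hp, fun q hq => ⟨_, h q, hE' q hq⟩⟩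
    | move E hE b p' hp' h =>
      obtain ⟨ψ, hψ, hp, hE'⟩ := ih hE hφu
      exact ⟨.act b ψ, .act b ψ hψ, ⟨p', hp', hp⟩,
        fun q ⟨q', hq', hq⟩ => ⟨_, h q q' hq', hE' q' hq⟩⟩
    | poll _ h =>
      exact ⟨P.readyObs p, P.isReadiness_readyObs p, sat_readyObs_iff.2 (.refl P p),
        fun q hq => ⟨u, h q (sat_readyObs_iff.1 hq), hφu⟩⟩

/-- The transition step of the congruence proof.  The right-hand sides of premises that occur in the
target occur there once, at a liquid position; so they can be replaced one after the other, and the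
other variables of the target all at once by the congruence property for the shorter observation
`φ`. -/
theorem TSS.WSProvable.exists_of_congrClosure {P : TSS L A V} (hstd : P.IsStandard)
    (hft : P.IsNtyftNtyxt) {Λ : ArgPred L} (hsafe : ∀ r ∈ P.rules, r.ReadinessSafe Λ) {φ : Obs A}
    (hφ : φ.IsReadiness)
    (hcongr : ∀ p q, CongrClosure P.ReadinessLE p q → P.Sat p φ → P.Sat q φ)
    {p : L.Term Empty} {a : A} {p' : L.Term Empty} (h : P.WSProvable (.pos p a p')) :
    ∀ q, CongrClosure P.ReadinessLE p q → ∀ D, LiquidContext Λ D → P.Sat (D p') φ →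
      ∃ q', P.WSProvable (.pos q a q') ∧ P.Sat (D q') φ := by
  classical
  have hla : ∀ r ∈ P.rules, r.NoLookahead := fun r hr => (hsafe r hr).1.1
  refine h.pos_induction hstd (C := fun p a p' => ∀ q, CongrClosure P.ReadinessLE p q →
    ∀ D, LiquidContext Λ D → P.Sat (D p') φ →
      ∃ q', P.WSProvable (.pos q a q') ∧ P.Sat (D q') φ) ?_
  intro r hr s a v hc σ above ih q hq D hD hsat
  have htt : r.IsNtytt := Rule.isNtytt (hft r hr)
  have hs : r.source = s := by rw [Rule.source, hc]; rfl
  have hfire : ∀ σ : V → L.Term Empty, (∀ β ∈ r.premises, P.WSProvable (β.subst σ)) →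
    P.WSProvable (r.conclusion.subst σ) := fun σ => .step r hr σ
  obtain hb | ⟨τ, rfl, hτ⟩ := Rule.exists_subst_of_congrClosure (hft r hr)
    (TSS.ReadinessLE.refl P) hs hq
  · have hroot := TSS.WSProvable.step r hr σ above
    rw [hc] at hroot
    obtain ⟨ψ, hψ, hp', hDψ⟩ := exists_obs_of_liquidContext hstd hft hsafe hφ hD hsat
    obtain ⟨-, q', hq', hq'ψ⟩ := hb ⟨.act a ψ hψ, v.subst σ, hroot, hp'⟩
    exact ⟨q', hq', hDψ q' hq'ψ⟩
  have hsubst : ∀ t : L.Term V, CongrClosure P.ReadinessLE (t.subst σ) (t.subst τ) :=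
    fun t => .subst fun x _ => hτ x
  have hle : ∀ t : L.Term V, P.InitialLE (t.subst σ) (t.subst τ) := fun t =>
    initialLE_of_congrClosure hstd hft hla ((hsubst t).mono fun _ _ h => h.initialLE)
  -- replace the values of the variables in `F`, one after the other
  have hrepl : ∀ F : Finset V, (∀ y ∈ F, r.IsRhs y ∧ Occurs y v) → ∃ θ : V → L.Term Empty,
      (∀ y, y ∉ F → θ y = σ y) ∧
      (∀ y ∈ F, ∀ t b, .pos t b (var y) ∈ r.premises → P.WSProvable (.pos (t.subst τ) b (θ y))) ∧
      P.Sat (D (v.subst θ)) φ := by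
    intro F
    induction F using Finset.induction_on with
    | empty => exact fun _ => ⟨σ, fun _ _ => rfl, by simp, hsat⟩
    | insert y F hyF ihF =>
      intro hF
      obtain ⟨θ, hoff, hon, hθ⟩ := ihF fun z hz => hF z (Finset.mem_insert_of_mem hz)
      obtain ⟨⟨β, hβ, hrhs⟩, hyv⟩ := hF y (Finset.mem_insert_self y F)
      cases β with
      | neg t b => exact hrhs.elim
      | pos t b u =>
        obtain rfl : u = var y := hrhs
        have hctx := hD.comp ((hsafe r hr).1.liquidContext_target hc (.inl ⟨_, hβ, rfl⟩) hyv θ .id)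
        obtain ⟨q', hq', hsat'⟩ := ih t b (var y) hβ _ (hsubst t) _ hctx (by
          simp only [FirstOrder.Language.Term.subst]
          rwa [← hoff y hyF, Function.update_eq_self])
        refine ⟨Function.update θ y q', fun z hz => ?_, fun z hz t' b' hβ' => ?_, hsat'⟩
        · rw [Finset.mem_insert, not_or] at hz
          rw [Function.update_of_ne hz.1, hoff z hz.2]
        · by_cases hzy : z = y
          · subst hzy
            have := htt.2.1 _ hβ _ hβ' (var z) rfl rfl
            cases this
            simpa using hq'
          · rw [Function.update_of_ne hzy]
            exact hon z (Finset.mem_of_mem_insert_of_ne hz hzy) t' b' hβ'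
  have hfin : {y | r.IsRhs y ∧ Occurs y v}.Finite :=
    (finite_setOf_occurs v).subset fun y hy => hy.2
  have hmem : ∀ {y}, y ∈ hfin.toFinset ↔ r.IsRhs y ∧ Occurs y v := fun {y} => by simp
  obtain ⟨θ, hoff, hon, hθ⟩ := hrepl hfin.toFinset fun y => hmem.1
  let θ' : V → L.Term Empty := fun y => if y ∈ hfin.toFinset then θ y else τ y
  have hθ'on : ∀ y, y ∈ hfin.toFinset → θ' y = θ y := fun y hy => if_pos hy
  have hθ'off : ∀ y, y ∉ hfin.toFinset → θ' y = τ y := fun y hy => if_neg hy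
  have hlhs : ∀ β ∈ r.premises, β.lhs.subst θ' = β.lhs.subst τ := fun β hβ =>
    subst_congr fun x hx => hθ'off x fun hy => (hla r hr).not_occurs (hmem.1 hy).1 hβ hx
  have hsrc : s.subst θ' = s.subst τ := subst_congr fun x hx => hθ'off x fun hy => by
    obtain ⟨β, hβ, hrhs⟩ := (hmem.1 hy).1
    exact htt.2.2 β hβ x hrhs (hs ▸ hx)
  refine ⟨v.subst θ', ?_, hcongr _ _ (hD.congrClosure (TSS.ReadinessLE.refl P)
    (.subst fun x _ => ?_)) hθ⟩
  · rw [← hsrc]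
    refine Rule.instance_of_polled htt (hla r hr) hc hfire θ' (fun t b hβ => ?_)
      (fun t b y hβ hy => ?_) fun t b y hβ _ => ?_
    · rw [show t.subst θ' = t.subst τ from hlhs _ hβ]
      exact (hle t).2 b (above _ hβ)
    · have hyF := hmem.2 ⟨⟨_, hβ, rfl⟩, hy⟩
      rw [show t.subst θ' = t.subst τ from hlhs _ hβ, hθ'on y hyF]
      exact hon y hyF t b hβ
    · rw [show t.subst θ' = t.subst τ from hlhs _ hβ]
      exact (hle t).1 b ⟨_, above _ hβ⟩
  · by_cases hx : x ∈ hfin.toFinset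
    · rw [hθ'on x hx]
      exact .base (.refl P _)
    · rw [hθ'off x hx, hoff x hx]
      exact hτ x

theorem TSS.sat_of_congrClosure {P : TSS L A V} (hstd : P.IsStandard)
    (hft : P.IsNtyftNtyxt) {Λ : ArgPred L} (hsafe : ∀ r ∈ P.rules, r.ReadinessSafe Λ) {φ : Obs A}
    (hφ : φ.IsReadiness) :
    ∀ p q, CongrClosure P.ReadinessLE p q → P.Sat p φ → P.Sat q φ := by
  induction hφ with
  | top => exact fun _ _ _ _ => trivial
  | ready a b =>
    intro p q hpq h
    have hle := initialLE_of_congrClosure hstd hft (fun r hr => (hsafe r hr).1.1)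
      (hpq.mono fun _ _ h => h.initialLE)
    rw [sat_ready_iff] at h ⊢
    exact ⟨fun i => hle.2 _ (h.1 i), fun j => hle.1 _ (h.2 j)⟩
  | act a φ hφ ih =>
    rintro p q hpq ⟨p', hp', hφp⟩
    exact hp'.exists_of_congrClosure hstd hft hsafe hφ ih q hpq _ .id hφp

end SOS

theorem mainTheorem2 {L : FirstOrder.Language} {A V : Type*}
    (hV : Infinite V) (hA : Nonempty (A ↪ V)) (hL : Nonempty ((Σ n, L.Functions n) ↪ V))
    (P : SOS.TSS L A V) (hstd : P.IsStandard) (hfmt : P.InReadinessFormat) :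
    SOS.IsPrecongruence P.ReadinessLE := by
  obtain ⟨hft, Λ, hsafe⟩ := hfmt
  refine ⟨.refl P, fun p q s hpq hqs => hpq.trans hqs, fun n f p q h φ ⟨hφ, hp⟩ => ⟨hφ, ?_⟩⟩
  exact SOS.TSS.sat_of_congrClosure hstd hft hsafe hφ _ _ (.func f p q fun i => .base (h i)) hp
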